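/- Let $G$ be a finite group and let $H\le G$ be a subgroup which is either a Frobenius complement in $G$ (that is, $1<H<G$ and $H\cap xHx^{-1}=1$ for every $x\in G\setminus H$) or trivial. Let $G$ act by left multiplication on the set $G/H$ of left cosets, and let $N\subseteq G$ be the Frobenius kernel: the set consisting of the identity and of all elements of $G$ that fix no point of $G/H$ (a normal subgroup of $G$, by a theorem of Frobenius). Put $n=|N|$ and $h=|H|$; then $|G/H|=n$. Identify each $g\in G$ with its permutation matrix, the real $n\times n$ matrix with rows and columns indexed by $G/H$ whose $(i,j)$ entry is $1$ if $g\cdot j=i$ and $0$ otherwise, and let $P(G)\subset\mathbb{R}^{n\times n}$ be the convex hull of these matrices. A face of a polytope $P$ is a set $P\cap\{A=0\}$, where $A$ is an affine function (possibly constant) with $A\ge 0$ on $P$ or $A\le 0$ on $P$; its dimension is that of its affine span, and $\dim\emptyset=-1$. A vertex is a face of dimension $0$, a facet is a face of dimension $\dim P-1$, and $P$ is simplicial if all its facets are simplices (convex hulls of finitely many affinely independent points, the empty set included). Then: 1. $P(G)$ is a simplicial polytope of dimension $|G|-|H|=(n-1)h$, with $|G|$ vertices and $n^h$ facets. 2.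 The faces of $P(G)$ not equal to $P(G)$ itself are exactly the convex hulls of the subsets $X\subseteq G$ that omit at least one element from each coset of $N$; the face that is the convex hull of such a set $X$ has dimension $|X|-1$. 3. If $T\subseteq G$ is a set of $h$ elements, one from each coset of $N$, then the convex hull of $G\setminus T$ is a facet of $P(G)$ whose set of vertices is $G\setminus T$, and all facets arise in this way. 4. For every integer $k\ge -1$, the number of $k$-dimensional faces of $P(G)$ (the empty face and $P(G)$ itself included) is the coefficient of $x^{k+1}$ in $x^{(n-1)h+1}+\bigl((1+x)^n-x^n\bigr)^h$. -/

import Mathlib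

open scoped Pointwise Polynomial

noncomputable section

namespace FrobPoly

section Groups

variable {G : Type*} [Group G]

/-- `H` is a Frobenius complement in `G`: `1 < H < G` and `H ∩ x H x⁻¹ = 1` for all `x ∉ H`. -/
def IsFrobeniusComplement (H : Subgroup G) : Prop :=
  ⊥ < H ∧ H < ⊤ ∧ ∀ x : G, x ∉ H → H ⊓ H.map (MulAut.conj x).toMonoidHom = ⊥

/-- The Frobenius kernel, for `G` acting on the left cosets `G ⧸ H` by left multiplication: the
identity together with all elements that have no fixed point. It is defined as a set; that it is
a normal subgroup is not presupposed. -/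
def frobeniusKernel (H : Subgroup G) : Set G :=
  {g | g = 1 ∨ ∀ x : G ⧸ H, g • x ≠ x}

/-- `X` omits at least one element of each coset `g N`. -/
def OmitsFromEachCoset (N : Set G) (X : Set G) : Prop :=
  ∀ g : G, ∃ x ∈ g • N, x ∉ X

/-- `T` contains exactly one element of each coset `g N`. -/
def IsCosetTransversal (N : Set G) (T : Set G) : Prop :=
  ∀ g : G, ∃! t : G, t ∈ T ∧ t ∈ g • N

open Classical in
/-- The permutation matrix of `g` acting on `G ⧸ H`: its `(i, j)` entry is `1` if `g j = i`
and `0` otherwise. -/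
def permMatrix (H : Subgroup G) (g : G) : Matrix (G ⧸ H) (G ⧸ H) ℝ :=
  Matrix.of fun i j => if g • j = i then 1 else 0

/-- The convex hull of the permutation matrices of the elements of `X ⊆ G`. -/
def hullOf (H : Subgroup G) (X : Set G) : Set (Matrix (G ⧸ H) (G ⧸ H) ℝ) :=
  convexHull ℝ (permMatrix H '' X)

/-- The Frobenius polytope `P(G)`. -/
def frobeniusPolytope (H : Subgroup G) : Set (Matrix (G ⧸ H) (G ⧸ H) ℝ) :=
  hullOf H Set.univ

end Groups

section Polytopes

variable {E : Type*} [AddCommGroup E] [Module ℝ E]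

/-- A polytope is the convex hull of a finite set of points. -/
def IsPolytope (P : Set E) : Prop :=
  ∃ s : Set E, s.Finite ∧ P = convexHull ℝ s

open Classical in
/-- The dimension of the affine span of `F`, with `dim ∅ = -1`. -/
def dim (F : Set E) : ℤ :=
  if F = ∅ then -1 else (Module.finrank ℝ (vectorSpan ℝ F) : ℤ)

/-- A face of `P` is `P ∩ {A = 0}` for an affine function `A` (possibly constant) such that `P`
lies on one side of `A`. In particular `∅` and `P` are faces. -/
def IsFace (P F : Set E) : Prop :=
  ∃ A : E →ᵃ[ℝ] ℝ, ((∀ p ∈ P, 0 ≤ A p) ∨ (∀ p ∈ P, A p ≤ 0)) ∧ F = P ∩ {p | A p = 0}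

/-- A facet is a face of dimension `dim P - 1`. -/
def IsFacet (P F : Set E) : Prop :=
  IsFace P F ∧ dim F = dim P - 1

/-- The vertices of `P`: the points `v` such that `{v}` is a (necessarily zero-dimensional) face. -/
def vertices (P : Set E) : Set E :=
  {v | IsFace P {v}}

/-- A simplex is the convex hull of finitely many affinely independent points (the empty set is
the simplex of dimension `-1`). -/
def IsSimplex (F : Set E) : Prop :=
  ∃ s : Set E, s.Finite ∧ AffineIndependent ℝ ((↑) : s → E) ∧ F = convexHull ℝ s

/-- A simplicial polytope is a polytope all of whose facets are simplices. -/
def IsSimplicialPolytope (P : Set E) : Prop :=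
  IsPolytope P ∧ ∀ F : Set E, IsFacet P F → IsSimplex F

end Polytopes

end FrobPoly

end

open FrobPoly

/-! A nonidentity element of G fixes at most one point of G/H. The inner product of the permutation
matrices of g and k counts the fixed points of g⁻¹k, so it is n if g = k, 0 if g and k are distinct
elements of one coset of N, and 1 otherwise. Hence each coset gives an (n-1)-simplex, the h
simplices share their barycenter, and their directions are mutually orthogonal: P(G) is a free sum
of simplices. `IsSimplexSum` isolates this Gram matrix. From it, `sum_smul_eq_zero_iff` identifies
the linear dependences as the functions constant on cosets with total sum zero. A set omitting a
point of each coset is therefore independent, and an explicit affine function exposes its hull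
(`isFace_of_omits`). Conversely, an affine function that is nonnegative on P(G) and zero on a whole
coset vanishes at the common barycenter, hence on all of P(G) (`isFace_ne_iff`). A face other than
P(G) is thus a choice of a proper subset of each coset, which yields ((1+x)^n - x^n)^h.

That N is a subgroup is Frobenius's theorem, proved with characters: every irreducible character of
H extends to a character of G that is constant on N (`exists_character_eq_extendFromComplement`). So
N lies in the kernels of these extensions, and they detect every element outside N. -/

namespace FrobPoly

/-! ### Complex characters of finite groups. -/

section Characters

open Representation Module

universe u

open scoped ComplexOrder MatrixOrder in
/-- Every finite-dimensional complex representation of a finite group is unitarizable. -/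
theorem exists_unitary_matrices {G V : Type*} [Group G] [Finite G] [AddCommGroup V] [Module ℂ V]
    [FiniteDimensional ℂ V] (ρ : Representation ℂ G V) :
    ∃ U : G →* Matrix (Fin (finrank ℂ V)) (Fin (finrank ℂ V)) ℂ,
      (∀ g, (U g).conjTranspose * U g = 1) ∧ (∀ g, ρ.character g = (U g).trace) ∧
        ∀ g, U g = 1 → ρ g = 1 := by
  classical
  have := Fintype.ofFinite G
  let e := LinearMap.toMatrixAlgEquiv (finBasis ℂ V)
  let M : G →* Matrix (Fin (finrank ℂ V)) (Fin (finrank ℂ V)) ℂ :=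
    (e : _ →* Matrix (Fin (finrank ℂ V)) (Fin (finrank ℂ V)) ℂ).comp ρ
  have hinv : ∀ g, M g⁻¹ * M g = 1 := fun g => by rw [← map_mul, inv_mul_cancel, map_one]
  -- Averaging gives an invariant positive definite form S = Bᴴ B; conjugation by B makes the
  -- representation unitary.
  let S := ∑ g, (M g).conjTranspose * M g
  have hS : S.PosDef := by
    refine Matrix.posDef_sum Finset.univ_nonempty fun g _ => ?_
    refine Matrix.PosDef.conjTranspose_mul_self _ ?_
    exact Matrix.mulVec_injective_of_isUnit (IsUnit.of_mul_eq_one_right _ (hinv g))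
  obtain ⟨B, hB⟩ := CStarAlgebra.nonneg_iff_eq_star_mul_self.mp hS.posSemidef.nonneg
  rw [Matrix.star_eq_conjTranspose] at hB
  have hBu : IsUnit B := by
    have := hS.isUnit
    rw [hB, Matrix.isUnit_iff_isUnit_det, Matrix.det_mul] at this
    rw [Matrix.isUnit_iff_isUnit_det]
    exact isUnit_of_mul_isUnit_right this
  have hBd : IsUnit B.det := (Matrix.isUnit_iff_isUnit_det B).mp hBu
  have hSinv : ∀ g, (M g).conjTranspose * S * M g = S := by
    intro g
    simp only [S, Finset.mul_sum, Finset.sum_mul]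
    refine Fintype.sum_bijective (· * g) (Group.mulRight_bijective g) _ _ fun k => ?_
    simp [Matrix.conjTranspose_mul, mul_assoc]
  refine ⟨⟨⟨fun g => B * M g * B⁻¹, ?_⟩, ?_⟩, ?_, ?_, ?_⟩
  · simp [Matrix.mul_nonsing_inv _ hBd]
  · intro x y
    simp only [map_mul]
    calc B * (M x * M y) * B⁻¹ = B * M x * 1 * M y * B⁻¹ := by simp [mul_assoc]
      _ = _ := by rw [← Matrix.nonsing_inv_mul _ hBd]; simp only [mul_assoc]
  · intro g
    change (B * M g * B⁻¹).conjTranspose * (B * M g * B⁻¹) = 1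
    calc _ = (B⁻¹).conjTranspose * ((M g).conjTranspose * (B.conjTranspose * B) * M g) * B⁻¹ := by
          simp only [Matrix.conjTranspose_mul, mul_assoc]
      _ = (B⁻¹).conjTranspose * (B.conjTranspose * B) * B⁻¹ := by rw [← hB, hSinv]
      _ = (B * B⁻¹).conjTranspose * (B * B⁻¹) := by
          simp only [Matrix.conjTranspose_mul, mul_assoc]
      _ = 1 := by simp [Matrix.mul_nonsing_inv _ hBd]
  · intro g
    change _ = (B * M g * B⁻¹).trace
    rw [Matrix.trace_mul_cycle, Matrix.nonsing_inv_mul _ hBd, one_mul, character,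
      LinearMap.trace_eq_matrix_trace ℂ (finBasis ℂ V)]
    rfl
  · intro g hg
    have hg' : B * M g * B⁻¹ = 1 := hg
    have : M g = 1 := by
      calc M g = (B⁻¹ * B) * M g * (B⁻¹ * B) := by simp [Matrix.nonsing_inv_mul _ hBd]
        _ = B⁻¹ * (B * M g * B⁻¹) * B := by simp only [mul_assoc]
        _ = 1 := by rw [hg', mul_one, Matrix.nonsing_inv_mul _ hBd]
    have h2 : e (ρ g) = e 1 := by rw [map_one]; exact this
    exact e.injective h2

theorem character_inv {G V : Type*} [Group G] [Finite G] [AddCommGroup V] [Module ℂ V]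
    [FiniteDimensional ℂ V] (ρ : Representation ℂ G V) (g : G) :
    ρ.character g⁻¹ = star (ρ.character g) := by
  obtain ⟨U, hU, hχ, -⟩ := exists_unitary_matrices ρ
  have h : U g⁻¹ = (U g).conjTranspose := by
    calc U g⁻¹ = (U g).conjTranspose * U g * U g⁻¹ := by rw [hU, one_mul]
      _ = _ := by rw [mul_assoc, ← map_mul, mul_inv_cancel, map_one, mul_one]
  rw [hχ, hχ, h, Matrix.trace_conjTranspose]

-- For U unitary of size d, the trace of (U - 1)ᴴ(U - 1) is 2d - 2 Re tr U, which vanishes when tr U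
-- = d.
open scoped ComplexOrder in
theorem eq_one_of_character_eq_finrank {G V : Type*} [Group G] [Finite G] [AddCommGroup V]
    [Module ℂ V] [FiniteDimensional ℂ V] (ρ : Representation ℂ G V) {g : G}
    (hg : ρ.character g = finrank ℂ V) : ρ g = 1 := by
  obtain ⟨U, hU, hχ, h1⟩ := exists_unitary_matrices ρ
  apply h1
  rw [← sub_eq_zero, ← Matrix.trace_conjTranspose_mul_self_eq_zero_iff]
  have : ((U g - 1).conjTranspose * (U g - 1)) = 1 + 1 - (U g).conjTranspose - U g := by
    rw [Matrix.conjTranspose_sub, sub_mul, mul_sub, hU]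
    simp; abel
  rw [this]
  simp [Matrix.trace_conjTranspose, ← hχ, hg]

theorem character_eq_add_of_isCompl {k G V : Type*} [Group G] [Field k] [AddCommGroup V]
    [Module k V] [FiniteDimensional k V] {ρ : Representation k G V} {σ τ : Subrepresentation ρ}
    (h : IsCompl σ.toSubmodule τ.toSubmodule) (g : G) :
    ρ.character g = σ.toRepresentation.character g + τ.toRepresentation.character g := by
  have hi := (DirectSum.isInternal_submodule_iff_isCompl
    (fun b : Bool => cond b σ.toSubmodule τ.toSubmodule) (i := true) (j := false) (by simp)
    (by ext b; cases b <;> simp)).mpr h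
  have hf : ∀ b : Bool, Set.MapsTo (ρ g) (cond b σ.toSubmodule τ.toSubmodule : Submodule k V)
      (cond b σ.toSubmodule τ.toSubmodule : Submodule k V) := by
    rintro (_ | _)
    · exact τ.apply_mem_toSubmodule g
    · exact σ.apply_mem_toSubmodule g
  have := LinearMap.trace_eq_sum_trace_restrict hi (f := ρ g) hf
  rw [character, this, Fintype.sum_bool]
  rfl

/-- A linear functional that vanishes on all irreducible characters vanishes on all characters. -/
theorem map_character_eq_zero {G : Type u} [Group G] [Finite G] (L : (G → ℂ) →ₗ[ℂ] ℂ)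
    (hL : ∀ (V : Type u) [AddCommGroup V] [Module ℂ V] [FiniteDimensional ℂ V]
      (ρ : Representation ℂ G V), ρ.IsIrreducible → L ρ.character = 0) (d : ℕ)
    (V : Type u) [AddCommGroup V] [Module ℂ V] [FiniteDimensional ℂ V]
    (hd : finrank ℂ V = d) (ρ : Representation ℂ G V) : L ρ.character = 0 := by
  induction d using Nat.strong_induction_on generalizing V with
  | _ d ih =>
    by_cases hirr : ρ.IsIrreducible
    · exact hL V ρ hirr
    rcases Nat.eq_zero_or_pos d with h0 | hpos
    · have : Subsingleton V := finrank_zero_iff.mp (hd.trans h0)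
      have : ρ.character = 0 := by
        ext g
        have : ρ g = 0 := Subsingleton.elim _ _
        simp [character, this]
      rw [this, map_zero]
    have hV : Nontrivial V := nontrivial_of_finrank_pos (hd ▸ hpos)
    have hbt : (⊥ : Subrepresentation ρ) ≠ ⊤ := fun h =>
      bot_ne_top (α := Submodule ℂ V) (congrArg Subrepresentation.toSubmodule h)
    obtain ⟨σ, hσ0, hσ1⟩ : ∃ σ : Subrepresentation ρ, σ ≠ ⊥ ∧ σ ≠ ⊤ := by
      by_contra! hcon
      refine hirr ?_
      have : Nontrivial (Subrepresentation ρ) := ⟨⊥, ⊤, hbt⟩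
      exact ⟨fun σ => or_iff_not_imp_left.mpr (hcon σ)⟩
    -- Maschke's theorem: both summands have smaller dimension.
    obtain ⟨τ, hτ⟩ := exists_isCompl σ
    have hc : IsCompl σ.toSubmodule τ.toSubmodule :=
      ⟨disjoint_iff.mpr (congrArg Subrepresentation.toSubmodule hτ.inf_eq_bot),
        codisjoint_iff.mpr (congrArg Subrepresentation.toSubmodule hτ.sup_eq_top)⟩
    have hsum := Submodule.finrank_add_eq_of_isCompl hc
    have hσpos : finrank ℂ σ.toSubmodule ≠ 0 := fun h =>
      hσ0 (Subrepresentation.toSubmodule_injective (Submodule.finrank_eq_zero.mp h))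
    have hσlt : finrank ℂ σ.toSubmodule < finrank ℂ V :=
      Submodule.finrank_lt fun h => hσ1 (Subrepresentation.toSubmodule_injective h)
    have hχ : ρ.character = σ.toRepresentation.character + τ.toRepresentation.character :=
      funext fun g => character_eq_add_of_isCompl hc g
    rw [hχ, map_add, ih _ (hd ▸ hσlt) _ rfl, ih _ (by omega) _ rfl, add_zero]

theorem character_leftRegular {G : Type u} [Group G] [Finite G] (g : G) [Decidable (g = 1)] :
    (leftRegular ℂ G).character g = if g = 1 then (Nat.card G : ℂ) else 0 := by
  classical
  have := Fintype.ofFinite G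
  let b : Basis G ℂ (MonoidAlgebra ℂ G) := .ofRepr (MonoidAlgebra.coeffLinearEquiv ℂ)
  have hb : ∀ x, b x = MonoidAlgebra.single x 1 := fun x => rfl
  rw [character, LinearMap.trace_eq_matrix_trace ℂ b, Matrix.trace]
  have : ∀ x : G, (LinearMap.toMatrix b b (leftRegular ℂ G g)).diag x = if g = 1 then 1 else 0 := by
    intro x
    rw [Matrix.diag_apply, LinearMap.toMatrix_apply, hb, ofMulAction_single]
    change (MonoidAlgebra.coeff (MonoidAlgebra.single (g • x) (1 : ℂ))) x = _
    simp [Finsupp.single_apply]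
  rw [Finset.sum_congr rfl fun x _ => this x]
  simp

/-- If `f 1 ≠ 0`, then `f` is not orthogonal to all irreducible characters. -/
theorem exists_irreducible_sum_ne_zero {G : Type u} [Group G] [Fintype G] (f : G → ℂ)
    (hf : f 1 ≠ 0) : ∃ (V : Type u) (_ : AddCommGroup V) (_ : Module ℂ V)
      (_ : FiniteDimensional ℂ V) (ρ : Representation ℂ G V), ρ.IsIrreducible ∧
        ∑ g, f g * ρ.character g⁻¹ ≠ 0 := by
  classical
  by_contra! hcon
  let L : (G → ℂ) →ₗ[ℂ] ℂ :=
    { toFun := fun u => ∑ g, f g * u g⁻¹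
      map_add' := fun u v => by simp [mul_add, Finset.sum_add_distrib]
      map_smul' := fun c u => by simp [Finset.mul_sum, mul_left_comm] }
  -- The regular character is |G| at the identity and 0 elsewhere, so `L` reads off `f 1` from it.
  have := map_character_eq_zero L (fun V _ _ hV ρ hρ => hcon V _ _ hV ρ hρ) _
    (MonoidAlgebra ℂ G) rfl (leftRegular ℂ G)
  have h2 : L (leftRegular ℂ G).character = f 1 * Nat.card G := by
    change ∑ g, f g * (leftRegular ℂ G).character g⁻¹ = _
    simp [character_leftRegular]
  rw [h2] at this
  simp [hf] at this

/-- Irreducible characters separate the identity from the other elements. -/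
theorem exists_irreducible_character_ne {G : Type u} [Group G] [Finite G] {g : G} (hg : g ≠ 1) :
    ∃ (V : Type u) (_ : AddCommGroup V) (_ : Module ℂ V)
      (_ : FiniteDimensional ℂ V) (ρ : Representation ℂ G V), ρ.IsIrreducible ∧
        ρ.character g ≠ ρ.character 1 := by
  classical
  by_contra! hcon
  let L : (G → ℂ) →ₗ[ℂ] ℂ := LinearMap.proj (R := ℂ) (φ := fun _ : G => ℂ) g - LinearMap.proj 1
  have := map_character_eq_zero L
    (fun V _ _ hV ρ hρ => by simp [-char_one, L, hcon V _ _ hV ρ hρ]) _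
    (MonoidAlgebra ℂ G) rfl (leftRegular ℂ G)
  simp [-char_one, L, character_leftRegular, hg] at this
  exact Nat.card_pos.ne' this

end Characters

end FrobPoly

namespace FrobPoly

/-! ### Frobenius's theorem. -/

section Frobenius

open Representation Module

universe u

/-- The common content of the two cases of the main hypothesis: a nontrivial element of `G` has
at most one fixed point in `G ⧸ H`. -/
def FixesAtMostOne {G : Type*} [Group G] (H : Subgroup G) : Prop :=
  ∀ g : G, g ≠ 1 → ∀ x y : G ⧸ H, g • x = x → g • y = y → x = y

theorem smul_mk_eq_mk_iff {G : Type*} [Group G] {H : Subgroup G} (g x : G) :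
    g • (x : G ⧸ H) = x ↔ x⁻¹ * g * x ∈ H := by
  rw [MulAction.Quotient.smul_coe, eq_comm, QuotientGroup.eq, smul_eq_mul, mul_assoc]

theorem fixesAtMostOne_of_isFrobeniusComplement_or_eq_bot {G : Type*} [Group G] {H : Subgroup G}
    (hH : IsFrobeniusComplement H ∨ H = ⊥) : FixesAtMostOne H := by
  intro g hg x y hx hy
  induction x using QuotientGroup.induction_on with | _ x
  induction y using QuotientGroup.induction_on with | _ y
  rw [smul_mk_eq_mk_iff] at hx hy
  rcases hH with ⟨-, -, hH⟩ | rfl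
  · by_contra hxy
    rw [QuotientGroup.eq] at hxy
    have h1 : x⁻¹ * g * x ∈ H ⊓ H.map (MulAut.conj (x⁻¹ * y)).toMonoidHom :=
      ⟨hx, y⁻¹ * g * y, hy, by simp [MulAut.conj_apply, mul_assoc]⟩
    rw [hH _ hxy, Subgroup.mem_bot] at h1
    apply hg
    calc g = x * (x⁻¹ * g * x) * x⁻¹ := by group
      _ = 1 := by rw [h1]; group
  · rw [Subgroup.mem_bot] at hx
    exfalso
    apply hg
    calc g = x * (x⁻¹ * g * x) * x⁻¹ := by group
      _ = 1 := by rw [hx]; group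

variable {G : Type u} [Group G]

theorem sum_stabilizer_eq [Fintype G] {H : Subgroup G} [Fintype H] {M : Type*} [AddCommMonoid M]
    (x : G) [∀ g : G, Decidable (g • (x : G ⧸ H) = x)] (F : G → M) :
    ∑ g, (if g • (x : G ⧸ H) = x then F g else 0) = ∑ k : H, F (x * k * x⁻¹) := by
  classical
  rw [← Finset.sum_filter]
  refine Finset.sum_bij'
    (fun g hg => ⟨x⁻¹ * g * x, (smul_mk_eq_mk_iff g x).mp (Finset.mem_filter.mp hg).2⟩)
    (fun k _ => x * k * x⁻¹) (by simp) ?_ ?_ ?_ ?_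
  · rintro k -
    simp only [Finset.mem_filter, Finset.mem_univ, true_and]
    rw [smul_mk_eq_mk_iff]
    convert k.2 using 1
    group
  · intro g _; group
  · intro k _; ext; simp [mul_assoc]
  · intro g _; simp [mul_assoc]

variable {H : Subgroup G}

open Classical in
/-- The function on `G` that takes the value `a 1` on the Frobenius kernel, and `a k` at the
conjugates of `k ∈ H`. -/
noncomputable def extendFromComplement [Finite G] (H : Subgroup G) (a : G → ℂ) (g : G) : ℂ :=
  letI := Fintype.ofFinite (G ⧸ H)
  -- When `a` is a class function on H, this is `a 1` plus the class function induced from `a - a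
  -- 1`. The terms vanish at g = 1.
  a 1 + ∑ x : G ⧸ H, if g • x = x then a (x.out⁻¹ * g * x.out) - a 1 else 0

theorem extendFromComplement_of_mem [Finite G] (a : G → ℂ) {g : G}
    (hg : g ∈ frobeniusKernel H) : extendFromComplement H a g = a 1 := by
  rcases hg with rfl | hg <;> simp [extendFromComplement, *]

theorem extendFromComplement_of_smul_eq [Finite G] (hH : FixesAtMostOne H) (a : G → ℂ) {g : G}
    (hg : g ≠ 1) {x : G ⧸ H} (hx : g • x = x) :
    extendFromComplement H a g = a (x.out⁻¹ * g * x.out) := by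
  classical
  have := Fintype.ofFinite (G ⧸ H)
  rw [extendFromComplement, Finset.sum_eq_single x]
  · simp [hx]
  · intro y _ hy
    rw [if_neg fun h => hy (hH g hg y x h hx)]
  · simp

theorem exists_smul_eq_of_notMem {g : G} (hg : g ∉ frobeniusKernel H) :
    g ≠ 1 ∧ ∃ x : G ⧸ H, g • x = x := by
  simpa [frobeniusKernel] using hg

theorem out_conj_mem {g : G} {x : G ⧸ H} (hx : g • x = x) : x.out⁻¹ * g * x.out ∈ H := by
  rw [← smul_mk_eq_mk_iff]
  simpa using hx

/-- Each value of the extension is a single value of `a`. This reduces the norm of an extension to a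
sum over H. -/
theorem extendFromComplement_mul_star [Finite G] (hH : FixesAtMostOne H) (a : G → ℂ) (g : G) :
    extendFromComplement H a g * star (extendFromComplement H a g) =
      extendFromComplement H (fun k => a k * star (a k)) g := by
  by_cases hg : g ∈ frobeniusKernel H
  · simp [extendFromComplement_of_mem _ hg]
  · obtain ⟨h1, x, hx⟩ := exists_smul_eq_of_notMem hg
    simp [extendFromComplement_of_smul_eq hH _ h1 hx]

/-- Frobenius reciprocity: since `b` is a class function, each point of G/H contributes the same sum
over H. -/
theorem sum_extendFromComplement_mul [Fintype G] [Fintype H] (a b : G → ℂ)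
    (hb : ∀ x g, b (x * g * x⁻¹) = b g) :
    ∑ g, extendFromComplement H a g * b g =
      a 1 * ∑ g, b g + Nat.card (G ⧸ H) * ∑ k : H, (a k - a 1) * b k := by
  classical
  have := Fintype.ofFinite (G ⧸ H)
  simp only [extendFromComplement, add_mul, Finset.sum_add_distrib, Finset.mul_sum, Finset.sum_mul,
    ite_mul, zero_mul]
  congr 1
  rw [Finset.sum_comm]
  have : ∀ x : G ⧸ H, ∑ g, (if g • x = x then (a (x.out⁻¹ * g * x.out) - a 1) * b g else 0) =
      ∑ k : H, (a k - a 1) * b k := by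
    intro x
    have h1 := sum_stabilizer_eq (H := H) x.out
      (fun g => (a (x.out⁻¹ * g * x.out) - a 1) * b g)
    simp only [QuotientGroup.out_eq'] at h1
    rw [h1]
    refine Finset.sum_congr rfl fun k _ => ?_
    rw [hb]
    congr 3
    group
  simp only [this, Finset.sum_const, Finset.card_univ, nsmul_eq_mul, ← Nat.card_eq_fintype_card,
    Finset.mul_sum]

open Classical in
/-- The character of a representation of `H`, extended by zero to `G`. -/
noncomputable def characterOn {V : Type*} [AddCommGroup V] [Module ℂ V]
    (σ : Representation ℂ H V) (g : G) : ℂ :=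
  if hg : g ∈ H then σ.character ⟨g, hg⟩ else 0

theorem characterOn_coe {V : Type*} [AddCommGroup V] [Module ℂ V]
    (σ : Representation ℂ H V) (k : H) : characterOn σ (k : G) = σ.character k := by
  simp [characterOn]

theorem characterOn_one {V : Type*} [AddCommGroup V] [Module ℂ V] [FiniteDimensional ℂ V]
    (σ : Representation ℂ H V) : characterOn σ (1 : G) = finrank ℂ V := by
  rw [← char_one σ, ← characterOn_coe]; rfl

/-- By reciprocity the pairing is a combination of dimensions: dim V · dim W^G + dim Hom_H(W, V) -
dim V · dim W^H. -/
theorem exists_int_sum_extendFromComplement {V W : Type*} [AddCommGroup V] [Module ℂ V]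
    [FiniteDimensional ℂ V] [AddCommGroup W] [Module ℂ W] [FiniteDimensional ℂ W] [Fintype G]
    (σ : Representation ℂ H V) (ρ : Representation ℂ G W) :
    ∃ m : ℤ, ∑ g, extendFromComplement H (characterOn σ) g * ρ.character g⁻¹ =
      Nat.card G * m := by
  classical
  have := Fintype.ofFinite H
  have hG0 : (Nat.card G : ℂ) ≠ 0 := by simp
  have hH0 : (Nat.card H : ℂ) ≠ 0 := by simp
  have := invertibleOfNonzero hG0
  have := invertibleOfNonzero hH0
  have hcard : (Nat.card G : ℂ) = Nat.card (G ⧸ H) * Nat.card H := by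
    rw [H.card_eq_card_quotient_mul_card_subgroup]; simp
  let ρH : Representation ℂ H W := ρ.comp H.subtype
  have hρH : ∀ k : H, ρ.character (k : G) = ρH.character k := fun k => rfl
  have e1 := card_inv_mul_sum_char_eq_finrank ρ
  have e2 := card_inv_mul_sum_char_eq_finrank ρH
  have e3 := card_inv_mul_sum_char_mul_char_eq_finrank ρH σ
  rw [inv_mul_eq_iff_eq_mul₀ (by assumption)] at e1 e2 e3
  refine ⟨finrank ℂ V * finrank ℂ (invariants ρ) + finrank ℂ (IntertwiningMap ρH σ)
    - finrank ℂ V * finrank ℂ (invariants ρH), ?_⟩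
  rw [sum_extendFromComplement_mul _ (fun g => ρ.character g⁻¹)
    (fun x g => by rw [mul_inv_rev, mul_inv_rev, inv_inv, ← mul_assoc, char_conj]),
    characterOn_one]
  have s1 : ∑ g, ρ.character g⁻¹ = ∑ g, ρ.character g :=
    Equiv.sum_comp (Equiv.inv G) ρ.character
  have s2 : ∑ k : H, ρH.character k⁻¹ = ∑ k, ρH.character k :=
    Equiv.sum_comp (Equiv.inv H) ρH.character
  have s3 : ∑ k : H, (characterOn σ (k : G) - finrank ℂ V) * ρ.character (k : G)⁻¹ =
      ∑ k : H, σ.character k * ρH.character k⁻¹ - finrank ℂ V * ∑ k : H, ρH.character k := by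
    rw [← s2, Finset.mul_sum, ← Finset.sum_sub_distrib]
    refine Finset.sum_congr rfl fun k _ => ?_
    rw [characterOn_coe, ← Subgroup.coe_inv, hρH, sub_mul]
  rw [s1, s3, e1, e2, e3, hcard]
  push_cast
  ring

/-- In a Frobenius group, every irreducible character of the complement extends to a character of
the whole group. -/
theorem exists_character_eq_extendFromComplement [Finite G] (hH : FixesAtMostOne H)
    {V : Type u} [AddCommGroup V] [Module ℂ V] [FiniteDimensional ℂ V]
    (σ : Representation ℂ H V) [σ.IsIrreducible] :
    ∃ (W : Type u) (_ : AddCommGroup W) (_ : Module ℂ W) (_ : FiniteDimensional ℂ W)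
      (ρ : Representation ℂ G W), ∀ g, ρ.character g = extendFromComplement H (characterOn σ) g := by
  classical
  have := Fintype.ofFinite G
  have := Fintype.ofFinite H
  have hG0 : (Nat.card G : ℂ) ≠ 0 := by simp
  have hH0 : (Nat.card H : ℂ) ≠ 0 := by simp
  have := invertibleOfNonzero hG0
  have := invertibleOfNonzero hH0
  have hcard : (Nat.card G : ℂ) = Nat.card (G ⧸ H) * Nat.card H := by
    rw [H.card_eq_card_quotient_mul_card_subgroup]; simp
  have hV : 0 < finrank ℂ V := by
    have := (irreducible_iff_isSimpleModule_asModule σ).mp inferInstance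
    have : Nontrivial V := IsSimpleModule.nontrivial (MonoidAlgebra ℂ H) σ.asModule
    exact finrank_pos
  set φ := extendFromComplement H (characterOn σ) with hφ
  have hφ1 : φ 1 = finrank ℂ V := by
    rw [hφ, extendFromComplement_of_mem _ (Or.inl rfl), characterOn_one]
  obtain ⟨W, i1, i2, i3, ρ, hρ, hne⟩ := exists_irreducible_sum_ne_zero φ
    (by rw [hφ1]; exact_mod_cast hV.ne')
  obtain ⟨m, hm⟩ := exists_int_sum_extendFromComplement σ ρ
  have hm0 : m ≠ 0 := by
    rintro rfl
    apply hne
    rw [hφ, hm]; simp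
  have hW : 0 < finrank ℂ W := by
    have := (irreducible_iff_isSimpleModule_asModule ρ).mp inferInstance
    have : Nontrivial W := IsSimpleModule.nontrivial (MonoidAlgebra ℂ G) ρ.asModule
    exact finrank_pos
  have nφ : ∑ g, φ g * star (φ g) = Nat.card G := by
    -- With |σ|² summing to |H|, the contributions of its value at 1 cancel, so φ has norm 1.
    have h1 := sum_extendFromComplement_mul (H := H)
      (fun k => characterOn σ k * star (characterOn σ k)) (fun _ => 1) (fun _ _ => rfl)
    have h2 := char_orthonormal σ σ
    rw [if_pos ⟨Representation.Equiv.refl σ⟩, inv_mul_eq_iff_eq_mul₀ hH0] at h2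
    simp only [character_inv] at h2
    simp only [hφ, extendFromComplement_mul_star hH]
    simp only [mul_one] at h1
    rw [h1, Finset.sum_sub_distrib]
    simp only [characterOn_coe, h2]
    simp only [Finset.sum_const, Finset.card_univ, nsmul_eq_mul, ← Nat.card_eq_fintype_card, hcard]
    ring
  have nρ : ∑ g, ρ.character g * star (ρ.character g) = Nat.card G := by
    have h2 := char_orthonormal ρ ρ
    rw [if_pos ⟨Representation.Equiv.refl ρ⟩, inv_mul_eq_iff_eq_mul₀ hG0] at h2
    simpa only [character_inv, mul_one] using h2
  have hx : ∑ g, φ g * star (ρ.character g) = Nat.card G * m := by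
    simpa only [character_inv] using hm
  have hx' : ∑ g, ρ.character g * star (φ g) = Nat.card G * m := by
    have := congrArg star hx
    simpa [mul_comm] using this
  -- The squared norm of φ - mρ is 1 - m². As m is a nonzero integer, this forces m² = 1 and φ = mρ.
  have key : ∑ g, (φ g - m * ρ.character g) * star (φ g - m * ρ.character g) =
      Nat.card G * (1 - m ^ 2) := by
    have : ∀ g, (φ g - m * ρ.character g) * star (φ g - m * ρ.character g) =
        φ g * star (φ g) - m * (φ g * star (ρ.character g)) - m * (ρ.character g * star (φ g))
          + m ^ 2 * (ρ.character g * star (ρ.character g)) := by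
      intro g
      simp
      ring
    simp only [this, Finset.sum_add_distrib, Finset.sum_sub_distrib, ← Finset.mul_sum, nφ, nρ, hx,
      hx']
    ring
  have keyR : ∑ g, ‖φ g - m * ρ.character g‖ ^ 2 = Nat.card G * (1 - (m : ℝ) ^ 2) := by
    have h3 : ((∑ g, ‖φ g - m * ρ.character g‖ ^ 2 : ℝ) : ℂ) =
        ((Nat.card G * (1 - (m : ℝ) ^ 2) : ℝ) : ℂ) := by
      push_cast
      rw [← key]
      exact Finset.sum_congr rfl fun g _ => (Complex.mul_conj' _).symm
    exact_mod_cast h3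
  have hm1 : (1 : ℝ) ≤ (m : ℝ) ^ 2 := by
    have : 1 ≤ m ^ 2 := by
      have := sq_pos_of_ne_zero hm0
      omega
    exact_mod_cast this
  have hzero : ∀ g, φ g = m * ρ.character g := by
    have h0 : ∑ g, ‖φ g - m * ρ.character g‖ ^ 2 = 0 := by
      refine le_antisymm ?_ (Finset.sum_nonneg fun _ _ => by positivity)
      rw [keyR]
      exact mul_nonpos_of_nonneg_of_nonpos (by positivity) (by linarith)
    intro g
    have := (Finset.sum_eq_zero_iff_of_nonneg fun _ _ => by positivity).mp h0 g (Finset.mem_univ g)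
    rw [sq_eq_zero_iff, norm_eq_zero, sub_eq_zero] at this
    exact this
  have hm2 : (m : ℝ) ^ 2 ≤ 1 := by
    have h0 : 0 ≤ Nat.card G * (1 - (m : ℝ) ^ 2) := by
      rw [← keyR]; exact Finset.sum_nonneg fun _ _ => by positivity
    have hp : (0 : ℝ) < Nat.card G := by exact_mod_cast Nat.card_pos
    nlinarith
  -- At the identity, dim V = m · dim W, which excludes m = -1.
  have hpos : 0 < m := by
    have h1 := hzero 1
    rw [hφ1, char_one] at h1
    have h2 : (finrank ℂ V : ℤ) = m * finrank ℂ W := by exact_mod_cast h1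
    have : 0 < m * (finrank ℂ W : ℤ) := by rw [← h2]; exact_mod_cast hV
    exact pos_of_mul_pos_left this (by positivity)
  have hme : m = 1 := by
    have : m ^ 2 ≤ 1 := by exact_mod_cast hm2
    nlinarith
  exact ⟨W, i1, i2, i3, ρ, fun g => by rw [hzero g, hme]; simp⟩

/-- If the product left the kernel it would be conjugate to some k ≠ 1 in H. An irreducible σ
separating k from 1 extends to some ρ that is trivial at both factors, hence at the product,
contradicting the choice of σ. -/
theorem mul_mem_frobeniusKernel [Finite G] (hH : FixesAtMostOne H) {g g' : G}
    (hg : g ∈ frobeniusKernel H) (hg' : g' ∈ frobeniusKernel H) : g * g' ∈ frobeniusKernel H := by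
  by_contra hn
  obtain ⟨h1, x, hx⟩ := exists_smul_eq_of_notMem hn
  set k : H := ⟨_, out_conj_mem hx⟩ with hk
  have hk1 : k ≠ 1 := by
    intro h
    apply h1
    have : x.out⁻¹ * (g * g') * x.out = 1 := congrArg Subtype.val h
    calc g * g' = x.out * (x.out⁻¹ * (g * g') * x.out) * x.out⁻¹ := by group
      _ = 1 := by rw [this]; group
  obtain ⟨V, i1, i2, i3, σ, hσ, hne⟩ := exists_irreducible_character_ne hk1
  obtain ⟨W, j1, j2, j3, ρ, hρ⟩ := exists_character_eq_extendFromComplement hH σ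
  have hker : ∀ u ∈ frobeniusKernel H, ρ u = 1 := fun u hu =>
    eq_one_of_character_eq_finrank ρ (by
      rw [← char_one ρ, hρ, hρ, extendFromComplement_of_mem _ hu,
        extendFromComplement_of_mem _ (Or.inl rfl)])
  have hgg : ρ (g * g') = 1 := by rw [map_mul, hker g hg, hker g' hg', one_mul]
  have e1 : ρ.character (g * g') = ρ.character 1 := by rw [character, character, hgg, map_one ρ]
  rw [hρ, hρ, extendFromComplement_of_mem _ (Or.inl rfl),
    extendFromComplement_of_smul_eq hH _ h1 hx] at e1
  apply hne
  rw [← characterOn_coe, ← characterOn_coe]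
  exact e1

/-- **Frobenius's theorem**: the Frobenius kernel is a subgroup. -/
def frobeniusKernelSubgroup [Finite G] (hH : FixesAtMostOne H) : Subgroup G where
  carrier := frobeniusKernel H
  one_mem' := Or.inl rfl
  mul_mem' := mul_mem_frobeniusKernel hH
  inv_mem' := by
    rintro g (rfl | hg)
    · exact Or.inl inv_one
    · exact Or.inr fun x hx => hg x (by rw [eq_comm, ← inv_smul_eq_iff, hx])

theorem mem_frobeniusKernelSubgroup [Finite G] (hH : FixesAtMostOne H) (g : G) :
    g ∈ frobeniusKernelSubgroup hH ↔ g ∈ frobeniusKernel H := Iff.rfl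

end Frobenius

end FrobPoly

namespace FrobPoly

/-! ### Faces and dimensions of convex hulls. -/

section Hulls

variable {E : Type*} [AddCommGroup E] [Module ℝ E]

theorem affineMap_combo (A : E →ᵃ[ℝ] ℝ) {x y : E} {a b : ℝ} (hab : a + b = 1) :
    A (a • x + b • y) = a * A x + b * A y := by
  simpa using Convex.combo_affine_apply (f := A) (x := x) (y := y) hab

theorem affineMap_nonneg_of_mem_convexHull {s : Set E} (A : E →ᵃ[ℝ] ℝ) (hA : ∀ p ∈ s, 0 ≤ A p)
    {p : E} (hp : p ∈ convexHull ℝ s) : 0 ≤ A p := by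
  have : convexHull ℝ s ⊆ A ⁻¹' Set.Ici 0 :=
    convexHull_min hA ((convex_Ici (0 : ℝ)).affine_preimage A)
  exact this hp

/-- The union of {A > 0} with the hull of the zeros of A in `s` is convex and contains `s`, hence
contains its hull. -/
theorem convexHull_inter_eq_zero {s : Set E} (A : E →ᵃ[ℝ] ℝ) (hA : ∀ p ∈ s, 0 ≤ A p) :
    convexHull ℝ s ∩ {p | A p = 0} = convexHull ℝ (s ∩ {p | A p = 0}) := by
  apply Set.Subset.antisymm
  · rintro p ⟨hp, hp0⟩
    have hK : Convex ℝ ({x | 0 < A x} ∪ convexHull ℝ (s ∩ {p | A p = 0})) := by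
      have hzero : ∀ x ∈ convexHull ℝ (s ∩ {p | A p = 0}), A x = 0 := fun x hx =>
        (convexHull_min Set.inter_subset_right ((convex_singleton (0 : ℝ)).affine_preimage A)) hx
      rw [convex_iff_forall_pos]
      rintro x hx y hy a b ha hb hab
      rcases hx with hx | hx <;> rcases hy with hy | hy
      · left
        simp only [Set.mem_ofPred_eq] at hx hy ⊢
        rw [affineMap_combo A hab]; positivity
      · left
        simp only [Set.mem_ofPred_eq] at hx ⊢
        rw [affineMap_combo A hab, hzero y hy]; simp; positivity
      · left
        simp only [Set.mem_ofPred_eq] at hy ⊢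
        rw [affineMap_combo A hab, hzero x hx]; simp; positivity
      · right
        exact convex_convexHull ℝ _ hx hy ha.le hb.le hab
    have hsub : convexHull ℝ s ⊆ {x | 0 < A x} ∪ convexHull ℝ (s ∩ {p | A p = 0}) := by
      refine convexHull_min (fun x hx => ?_) hK
      rcases (hA x hx).lt_or_eq with h | h
      · exact Or.inl h
      · exact Or.inr (subset_convexHull ℝ _ ⟨hx, h.symm⟩)
    rcases hsub hp with h | h
    · exact absurd hp0 (ne_of_gt h)
    · exact h
  · refine Set.subset_inter (convexHull_mono Set.inter_subset_left) ?_
    exact convexHull_min Set.inter_subset_right ((convex_singleton (0 : ℝ)).affine_preimage A)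

theorem isFace_convexHull_image_iff {α : Type*} (P : α → E) (S : Set α) (F : Set E) :
    IsFace (convexHull ℝ (P '' S)) F ↔ ∃ A : E →ᵃ[ℝ] ℝ, (∀ a ∈ S, 0 ≤ A (P a)) ∧
      F = convexHull ℝ (P '' {a ∈ S | A (P a) = 0}) := by
  have himg : ∀ A : E →ᵃ[ℝ] ℝ, P '' {a ∈ S | A (P a) = 0} = P '' S ∩ {p | A p = 0} := by
    intro A
    ext p
    constructor
    · rintro ⟨a, ⟨ha, h0⟩, rfl⟩; exact ⟨⟨a, ha, rfl⟩, h0⟩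
    · rintro ⟨⟨a, ha, rfl⟩, h0⟩; exact ⟨a, ⟨ha, h0⟩, rfl⟩
  constructor
  · rintro ⟨A, hA | hA, rfl⟩
    · have h : ∀ p ∈ P '' S, 0 ≤ A p := fun p hp => hA p (subset_convexHull ℝ _ hp)
      exact ⟨A, fun a ha => h _ ⟨a, ha, rfl⟩, by rw [himg, convexHull_inter_eq_zero A h]⟩
    · have h : ∀ p ∈ P '' S, 0 ≤ (-A) p := fun p hp => by
        simpa using hA p (subset_convexHull ℝ _ hp)
      refine ⟨-A, fun a ha => h _ ⟨a, ha, rfl⟩, ?_⟩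
      rw [himg, ← convexHull_inter_eq_zero (-A) h]
      simp
  · rintro ⟨A, hA, rfl⟩
    have h : ∀ p ∈ P '' S, 0 ≤ A p := by rintro _ ⟨a, ha, rfl⟩; exact hA a ha
    exact ⟨A, Or.inl fun p hp => affineMap_nonneg_of_mem_convexHull A h hp,
      by rw [himg, convexHull_inter_eq_zero A h]⟩

theorem isFace_self (S : Set E) : IsFace S S :=
  ⟨0, Or.inl fun _ _ => le_rfl, by simp⟩

theorem finite_setOf_isFace_convexHull_image {α : Type*} [Finite α] (P : α → E) (S : Set α) :
    {F | IsFace (convexHull ℝ (P '' S)) F}.Finite := by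
  refine (Set.finite_range fun Y : Set α => convexHull ℝ (P '' Y)).subset fun F hF => ?_
  obtain ⟨A, -, rfl⟩ := (isFace_convexHull_image_iff P S F).mp hF
  exact ⟨_, rfl⟩

theorem dim_convexHull_image {α : Type*} [Finite α] (P : α → E) (X : Set α)
    (hX : AffineIndependent ℝ fun a : X => P a) :
    dim (convexHull ℝ (P '' X)) = (X.ncard : ℤ) - 1 := by
  classical
  have := Fintype.ofFinite X
  rcases X.eq_empty_or_nonempty with rfl | hne
  · simp [dim]
  · have hpos : 0 < X.ncard := (Set.ncard_pos).mpr hne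
    have hc : Fintype.card X = (X.ncard - 1) + 1 := by
      rw [← Nat.card_eq_fintype_card, Nat.card_coe_set_eq]; omega
    have h1 := hX.finrank_vectorSpan hc
    have h2 : Set.range (fun a : X => P a) = P '' X := by rw [Set.image_eq_range]
    rw [h2] at h1
    have hd : convexHull ℝ (P '' X) ≠ ∅ := by
      rw [Ne, convexHull_eq_empty]; exact (hne.image P).ne_empty
    rw [dim, if_neg hd, ← direction_affineSpan, affineSpan_convexHull, direction_affineSpan, h1]
    omega

theorem sum_eq_sum_coe_of_support_subset {α M : Type*} [Fintype α] [AddCommMonoid M] {X : Set α}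
    [Fintype X] (u : α → M) (hu : ∀ a ∉ X, u a = 0) : ∑ a, u a = ∑ a : X, u a := by
  rw [← Finset.sum_subset (Finset.subset_univ X.toFinset) (fun a _ ha => hu a (by simpa using ha))]
  exact Finset.sum_subtype _ (fun a => by simp) u

/-- Extending coefficients by zero lets the dependences be described once, on all of `α`. -/
theorem affineIndependent_restrict {α : Type*} [Fintype α] (P : α → E) (X : Set α)
    (h : ∀ f : α → ℝ, (∀ a ∉ X, f a = 0) → ∑ a, f a = 0 → ∑ a, f a • P a = 0 → f = 0) :
    AffineIndependent ℝ fun a : X => P a := by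
  classical
  rw [affineIndependent_iff]
  intro s w hw hwP e he
  let f : α → ℝ := fun a => if ha : a ∈ X then (if (⟨a, ha⟩ : X) ∈ s then w ⟨a, ha⟩ else 0) else 0
  have hval : ∀ a : X, f a = if a ∈ s then w a else 0 := fun a => by simp [f]
  have hout : ∀ a ∉ X, f a = 0 := fun a ha => by simp [f, ha]
  have hf := h f hout ?_ ?_
  · have := hval e
    rw [hf, if_pos he] at this
    simpa using this.symm
  · rw [sum_eq_sum_coe_of_support_subset (X := X) f hout]
    simpa [hval, Finset.sum_ite_mem] using hw
  · rw [sum_eq_sum_coe_of_support_subset (X := X) (fun a => f a • P a)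
      fun a ha => by simp [hout a ha]]
    simpa [hval, ite_smul, Finset.sum_ite_mem] using hwP

end Hulls

/-! ### Free sums of simplices. -/

section Configurations

open Classical in
/-- A configuration of points `P a`, spread over fibers of size `n` of a map `π`, that has the
same affine dependencies as the vertices of simplices (one for each fiber) that meet only in
their common barycenter. The functional `L a` plays the role of the inner product with `P a`. -/
structure IsSimplexSum {α Q E : Type*} [AddCommGroup E] [Module ℝ E] [Fintype α]
    (n : ℕ) (π : α → Q) (P : α → E) (L : α → E →ₗ[ℝ] ℝ) : Prop where
  surjective : Function.Surjective π
  ncard_fiber : ∀ q, {a | π a = q}.ncard = n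
  gram : ∀ a b, L a (P b) = (if b = a then (n : ℝ) else 0) + 1 - (if π b = π a then 1 else 0)
  eq_zero : ∀ f : α → ℝ, (∀ a, L a (∑ b, f b • P b) = 0) → ∑ b, f b • P b = 0
  -- If n = 1, points of different fibers would coincide.
  two_le : 2 ≤ n ∨ Subsingleton Q

namespace IsSimplexSum

variable {α Q E : Type*} [AddCommGroup E] [Module ℝ E] [Fintype α]
  {n : ℕ} {π : α → Q} {P : α → E} {L : α → E →ₗ[ℝ] ℝ}

open Classical in
theorem card_filter (hP : IsSimplexSum n π P L)
    (q : Q) : (Finset.univ.filter fun a => π a = q).card = n := by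
  rw [← hP.ncard_fiber q, Set.ncard_eq_toFinset_card']
  congr 1
  ext; simp

theorem n_pos (hP : IsSimplexSum n π P L) [Nonempty α] : 0 < n := by
  classical
  let a := Classical.arbitrary α
  rw [← hP.card_filter (π a), Finset.card_pos]
  exact ⟨a, by simp⟩

theorem finite_fibers (hP : IsSimplexSum n π P L) : Finite Q := Finite.of_surjective π hP.surjective

theorem card_eq (hP : IsSimplexSum n π P L) : Fintype.card α = n * Nat.card Q := by
  classical
  have := hP.finite_fibers
  have := Fintype.ofFinite Q
  rw [← Finset.card_univ, Finset.card_eq_sum_card_fiberwise (f := π) (t := Finset.univ) (by simp)]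
  simp [hP.card_filter, mul_comm]

open Classical in
theorem map_sum (hP : IsSimplexSum n π P L) (f : α → ℝ) (a : α) :
    L a (∑ b, f b • P b) = n * f a + ∑ b, f b - ∑ b with π b = π a, f b := by
  rw [_root_.map_sum]
  simp only [map_smul, hP.gram, smul_eq_mul, mul_sub, mul_add, Finset.sum_sub_distrib,
    Finset.sum_add_distrib, mul_ite, mul_zero, mul_one, Finset.sum_ite_eq', Finset.mem_univ,
    if_true, Finset.sum_filter]
  ring

/-- Pairing with `L a` gives n f(a) + (total sum) - (fiber sum) = 0. Comparing two points of a fiber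
shows that f is constant there; then the fiber sum is n f(a), and the total must vanish. -/
theorem sum_smul_eq_zero_iff (hP : IsSimplexSum n π P L) [Nonempty α] (f : α → ℝ) :
    ∑ a, f a • P a = 0 ↔ (∀ a b, π a = π b → f a = f b) ∧ ∑ a, f a = 0 := by
  classical
  have hn : (n : ℝ) ≠ 0 := by exact_mod_cast hP.n_pos.ne'
  have hfib : (∀ a b, π a = π b → f a = f b) → ∀ a, ∑ b with π b = π a, f b = n * f a := by
    intro hf a
    rw [Finset.sum_congr rfl fun b hb => hf b a (Finset.mem_filter.mp hb).2]
    simp [hP.card_filter]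
  constructor
  · intro h
    have h1 : ∀ a, n * f a + ∑ b, f b - ∑ b with π b = π a, f b = 0 := fun a => by
      rw [← hP.map_sum, h, map_zero]
    have h2 : ∀ a b, π a = π b → f a = f b := by
      intro a b hab
      have ha := h1 a
      have hb := h1 b
      rw [← hab] at hb
      exact mul_left_cancel₀ hn (by linarith)
    refine ⟨h2, ?_⟩
    have := h1 (Classical.arbitrary α)
    rw [hfib h2] at this
    linarith
  · rintro ⟨h1, h2⟩
    refine hP.eq_zero f fun a => ?_
    rw [hP.map_sum, hfib h1, h2]
    ring

-- The simplices share their barycenter: the difference of two fiber indicators is a dependence.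
open Classical in
theorem sum_fiber_eq (hP : IsSimplexSum n π P L)
    [Nonempty α] (q q' : Q) : ∑ a with π a = q, P a = ∑ a with π a = q', P a := by
  have := (hP.sum_smul_eq_zero_iff
    fun a => (if π a = q then (1 : ℝ) else 0) - (if π a = q' then 1 else 0)).mpr
      ⟨fun a b hab => by simp [hab], by
        rw [Finset.sum_sub_distrib]; simp [hP.card_filter]⟩
  rw [← sub_eq_zero, ← this]
  simp [sub_smul, Finset.sum_filter, ite_smul]

/-- Thus `n - L a` exposes `P a` as a vertex. -/
theorem gram_lt (hP : IsSimplexSum n π P L) {a b : α} (hab : b ≠ a) : L a (P b) < n := by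
  classical
  have : Nonempty α := ⟨a⟩
  have hn : (1 : ℝ) ≤ n := by exact_mod_cast hP.n_pos
  rw [hP.gram, if_neg hab]
  split_ifs with h
  · linarith
  · rcases hP.two_le with h2 | h2
    · have : (2 : ℝ) ≤ n := by exact_mod_cast h2
      linarith
    · exact absurd (Subsingleton.elim _ _) h

theorem gram_self (hP : IsSimplexSum n π P L) (a : α) : L a (P a) = n := by
  rw [hP.gram]; simp

theorem vertices_convexHull (hP : IsSimplexSum n π P L)
    (X : Set α) : vertices (convexHull ℝ (P '' X)) = P '' X := by
  ext v
  simp only [vertices, Set.mem_ofPred_eq, isFace_convexHull_image_iff]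
  constructor
  · rintro ⟨A, -, hv⟩
    have hne : (P '' {a ∈ X | A (P a) = 0}).Nonempty := by
      rw [← convexHull_nonempty_iff (𝕜 := ℝ), ← hv]; simp
    obtain ⟨_, a, ha, rfl⟩ := hne
    have : P a ∈ convexHull ℝ (P '' {a ∈ X | A (P a) = 0}) := subset_convexHull ℝ _ ⟨a, ha, rfl⟩
    rw [← hv, Set.mem_singleton_iff] at this
    exact ⟨a, ha.1, this⟩
  · rintro ⟨a, ha, rfl⟩
    refine ⟨AffineMap.const ℝ E (n : ℝ) - (L a).toAffineMap, fun b _ => ?_, ?_⟩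
    · by_cases hb : b = a
      · subst hb; simp [hP.gram_self]
      · simpa using (hP.gram_lt hb).le
    · have : {b ∈ X | (AffineMap.const ℝ E (n : ℝ) - (L a).toAffineMap) (P b) = 0} = {a} := by
        ext b
        simp only [Set.mem_ofPred_eq, Set.mem_singleton_iff]
        constructor
        · rintro ⟨-, hb⟩
          by_contra hba
          have := hP.gram_lt hba
          simp at hb
          linarith
        · rintro rfl
          exact ⟨ha, by simp [hP.gram_self]⟩
      rw [this]; simp

theorem injective (hP : IsSimplexSum n π P L) : Function.Injective P := by
  intro a b hab
  by_contra h
  have := hP.gram_lt (a := a) (b := b) (Ne.symm h)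
  rw [← hab, hP.gram_self] at this
  exact lt_irrefl _ this

theorem convexHull_image_injective (hP : IsSimplexSum n π P L)
    : Function.Injective fun X : Set α => convexHull ℝ (P '' X) := by
  intro X Y hXY
  have := congrArg vertices hXY
  simp only [hP.vertices_convexHull] at this
  exact hP.injective.image_injective this

/-- A dependence is constant on each fiber and zero at an omitted point of it. -/
theorem affineIndependent_of_omits (hP : IsSimplexSum n π P L)
    [Nonempty α] {X : Set α} (hX : ∀ q, ∃ a, π a = q ∧ a ∉ X) :
    AffineIndependent ℝ fun a : X => P a := by
  refine affineIndependent_restrict P X fun f hf _ hfP => ?_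
  ext a
  obtain ⟨b, hb, hbX⟩ := hX (π a)
  rw [((hP.sum_smul_eq_zero_iff f).mp hfP).1 a b hb.symm, hf b hbX]
  rfl

theorem dim_of_omits (hP : IsSimplexSum n π P L)
    [Nonempty α] {X : Set α} (hX : ∀ q, ∃ a, π a = q ∧ a ∉ X) :
    dim (convexHull ℝ (P '' X)) = (X.ncard : ℤ) - 1 :=
  dim_convexHull_image P X (hP.affineIndependent_of_omits hX)

/-- Any prescribed values on the points with equal fiber sums come from an affine function; here the
values are zero exactly on `X`. -/
theorem isFace_of_omits (hP : IsSimplexSum n π P L)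
    [Nonempty α] {X : Set α} (hX : ∀ q, ∃ a, π a = q ∧ a ∉ X) :
    IsFace (convexHull ℝ (P '' Set.univ)) (convexHull ℝ (P '' X)) := by
  classical
  have := hP.finite_fibers
  have := Fintype.ofFinite Q
  have hn : (n : ℝ) ≠ 0 := by exact_mod_cast hP.n_pos.ne'
  let m : Q → Finset α := fun q => Finset.univ.filter fun a => π a = q ∧ a ∉ X
  have hm : ∀ q, (0 : ℝ) < (m q).card := by
    intro q
    obtain ⟨a, ha⟩ := hX q
    exact_mod_cast Finset.card_pos.mpr ⟨a, by simp [m, ha]⟩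
  -- Equal weights on the omitted points make every fiber sum 1.
  let c : α → ℝ := fun a => if a ∈ X then 0 else ((m (π a)).card : ℝ)⁻¹
  have hfib : ∀ q, ∑ a with π a = q, c a = 1 := by
    intro q
    have h1 : ∑ a with π a = q, c a = ∑ a ∈ m q, ((m q).card : ℝ)⁻¹ := by
      simp only [m, Finset.sum_filter, c]
      refine Finset.sum_congr rfl fun a _ => ?_
      by_cases hq : π a = q <;> by_cases ha : a ∈ X <;> simp [hq, ha]
    rw [h1, Finset.sum_const, nsmul_eq_mul, mul_inv_cancel₀ (hm q).ne']
  have htot : ∑ a, c a = Nat.card Q := by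
    rw [← Finset.sum_fiberwise Finset.univ π c]
    simp [hfib]
  -- The Gram matrix gives ∑ c(a) L_a(P_b) = n c(b) + |Q| - 1, whence the constant.
  let A : E →ᵃ[ℝ] ℝ := (∑ a, (c a / n) • L a).toAffineMap -
    AffineMap.const ℝ E (((Nat.card Q : ℝ) - 1) / n)
  have hA : ∀ b, A (P b) = c b := by
    intro b
    have hsymm : ∀ a, L a (P b) = L b (P a) := by
      intro a
      simp only [hP.gram, eq_comm]
    have h1 := hP.map_sum c b
    rw [_root_.map_sum, htot, hfib] at h1
    have h2 : A (P b) = (∑ a, L b (c a • P a)) / n - ((Nat.card Q : ℝ) - 1) / n := by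
      simp only [A, AffineMap.coe_sub, Pi.sub_apply, LinearMap.coe_toAffineMap,
        LinearMap.sum_apply, LinearMap.smul_apply, hsymm, AffineMap.const_apply, map_smul,
        smul_eq_mul, Finset.sum_div]
      congr 1
      refine Finset.sum_congr rfl fun a _ => ?_
      ring
    rw [h2, h1]
    field_simp
    ring
  rw [isFace_convexHull_image_iff]
  have hc : ∀ a, a ∉ X → 0 < c a := fun a ha => by simp [c, ha, hm]
  refine ⟨A, fun a _ => ?_, ?_⟩
  · rw [hA]
    by_cases ha : a ∈ X
    · simp [c, ha]
    · exact (hc a ha).le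
  · congr 2
    ext a
    simp only [Set.mem_univ, true_and, Set.mem_ofPred_eq, hA]
    by_cases ha : a ∈ X
    · simp [c, ha]
    · simp [ha, (hc a ha).ne']

/-- An affine function has the same sum over every fiber. If it is nonnegative at the points and
zero on one whole fiber, it is zero at all of them, and the face is everything. -/
theorem isFace_ne_iff (hP : IsSimplexSum n π P L) [Nonempty α] (F : Set E) :
    (IsFace (convexHull ℝ (P '' Set.univ)) F ∧ F ≠ convexHull ℝ (P '' Set.univ)) ↔
      ∃ X : Set α, (∀ q, ∃ a, π a = q ∧ a ∉ X) ∧ F = convexHull ℝ (P '' X) := by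
  classical
  constructor
  · rintro ⟨hF, hne⟩
    obtain ⟨A, hA, rfl⟩ := (isFace_convexHull_image_iff P Set.univ F).mp hF
    refine ⟨_, fun q => ?_, rfl⟩
    by_contra! hcon
    have hq : ∀ a, π a = q → A (P a) = 0 := fun a ha => (hcon a ha).2
    have hfib : ∀ q, ∑ a with π a = q, A (P a) = A.linear (∑ a with π a = q, P a) + n * A 0 := by
      intro q
      rw [_root_.map_sum, ← hP.card_filter q, ← nsmul_eq_mul, ← Finset.sum_const,
        ← Finset.sum_add_distrib]
      refine Finset.sum_congr rfl fun a _ => ?_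
      rw [A.decomp']
      simp
    have hall : ∀ a, A (P a) = 0 := by
      intro a
      have h0 : ∑ b with π b = π a, A (P b) = 0 := by
        rw [hfib, hP.sum_fiber_eq (π a) q, ← hfib]
        exact Finset.sum_eq_zero fun b hb => hq b (Finset.mem_filter.mp hb).2
      exact (Finset.sum_eq_zero_iff_of_nonneg fun b _ => hA b trivial).mp h0 a (by simp)
    apply hne
    simp [hall]
  · rintro ⟨X, hX, rfl⟩
    refine ⟨hP.isFace_of_omits hX, fun h => ?_⟩
    have := hP.convexHull_image_injective h
    obtain ⟨a, -, ha⟩ := hX (π (Classical.arbitrary α))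
    exact ha (this ▸ Set.mem_univ a)

theorem dim_convexHull_univ (hP : IsSimplexSum n π P L) [Nonempty α] :
    dim (convexHull ℝ (P '' Set.univ)) = (Fintype.card α : ℤ) - Nat.card Q := by
  classical
  have := hP.finite_fibers
  have := Fintype.ofFinite Q
  let s := Function.surjInv hP.surjective
  have hs : ∀ q, π (s q) = q := Function.surjInv_eq hP.surjective
  let y₀ := Classical.arbitrary α
  let q₀ := π y₀
  -- Dropping one point from every fiber but one leaves an affinely independent set with the same
  -- span; each dropped point is recovered from the equality of the fiber sums.
  let Z : Set α := s '' {q | q ≠ q₀}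
  have hy₀ : ∀ a, π a = q₀ → a ∈ Zᶜ := by
    rintro _ ha ⟨q, hq, rfl⟩
    exact hq ((hs q).symm.trans ha)
  have hind : AffineIndependent ℝ fun a : (Zᶜ : Set α) => P a := by
    refine affineIndependent_restrict P _ fun f hf _ hfP => ?_
    obtain ⟨h1, h2⟩ := (hP.sum_smul_eq_zero_iff f).mp hfP
    have h3 : ∀ a, π a ≠ q₀ → f a = 0 := by
      intro a ha
      rw [h1 a (s (π a)) (hs _).symm]
      exact hf _ fun h => h ⟨π a, ha, rfl⟩
    have h4 : f y₀ = 0 := by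
      rw [← Finset.sum_fiberwise Finset.univ π f, Finset.sum_eq_single q₀] at h2
      · rw [Finset.sum_congr rfl fun b hb => h1 b y₀ (Finset.mem_filter.mp hb).2] at h2
        simpa [hP.card_filter, hP.n_pos.ne'] using h2
      · intro q _ hq
        exact Finset.sum_eq_zero fun b hb => h3 b (by rw [(Finset.mem_filter.mp hb).2]; exact hq)
      · simp
    ext a
    by_cases ha : π a = q₀
    · rw [h1 a y₀ ha, h4]; rfl
    · exact h3 a ha
  have hZ : Z.ncard = Nat.card Q - 1 := by
    rw [Set.ncard_image_of_injective _ (Function.injective_surjInv hP.surjective)]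
    have : {q | q ≠ q₀} = ({q₀} : Set Q)ᶜ := by ext; simp
    rw [this, Set.ncard_compl, Set.ncard_singleton]
  have hpos : 0 < Nat.card Q := by
    have : Nonempty Q := ⟨q₀⟩
    exact Nat.card_pos
  have hZle : Z.ncard ≤ Fintype.card α := by
    rw [← Nat.card_eq_fintype_card]; exact Set.ncard_le_card Z
  have hZc : (Zᶜ.ncard : ℤ) - 1 = (Fintype.card α : ℤ) - Nat.card Q := by
    rw [Set.ncard_compl, Nat.card_eq_fintype_card]; omega
  rw [← hZc, ← dim_convexHull_image P _ hind]
  have hspan : vectorSpan ℝ (P '' Set.univ) = vectorSpan ℝ (P '' Zᶜ) := by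
    refine le_antisymm ?_ (vectorSpan_mono ℝ (Set.image_mono (Set.subset_univ _)))
    have hD : ∀ b ∈ Zᶜ, P b - P y₀ ∈ vectorSpan ℝ (P '' Zᶜ) := fun b hb =>
      vsub_mem_vectorSpan ℝ ⟨b, hb, rfl⟩ ⟨y₀, hy₀ y₀ rfl, rfl⟩
    have hD' : ∀ b, P b - P y₀ ∈ vectorSpan ℝ (P '' Zᶜ) := by
      intro b
      by_cases hb : b ∈ Zᶜ
      · exact hD b hb
      obtain ⟨q, hq, rfl⟩ := not_not.mp hb
      have hsum : ∀ q, ∑ a with π a = q, (P a - P y₀) = ∑ a with π a = q, P a - n • P y₀ := by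
        intro q
        rw [Finset.sum_sub_distrib, Finset.sum_const, hP.card_filter]
      have h1 : ∑ a with π a = q, (P a - P y₀) = ∑ a with π a = q₀, (P a - P y₀) := by
        rw [hsum, hsum, hP.sum_fiber_eq q q₀]
      rw [← Finset.add_sum_erase _ _ (show s q ∈ Finset.univ.filter fun a => π a = q by simp [hs]),
        ← eq_sub_iff_add_eq] at h1
      rw [h1]
      refine Submodule.sub_mem _ (Submodule.sum_mem _ fun a ha => ?_)
        (Submodule.sum_mem _ fun a ha => ?_)
      · exact hD a (hy₀ a (Finset.mem_filter.mp ha).2)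
      · rw [Finset.mem_erase, Finset.mem_filter] at ha
        refine hD a ?_
        rintro ⟨q', -, rfl⟩
        apply ha.1
        rw [← ha.2.2, hs]
    rw [vectorSpan_eq_span_vsub_set_right ℝ (Set.mem_image_of_mem P (Set.mem_univ y₀)),
      Submodule.span_le]
    rintro _ ⟨_, ⟨b, -, rfl⟩, rfl⟩
    exact hD' b
  have hne : ∀ X : Set α, y₀ ∈ X → convexHull ℝ (P '' X) ≠ ∅ := by
    intro X hX
    rw [Ne, convexHull_eq_empty]
    exact Set.Nonempty.ne_empty ⟨P y₀, y₀, hX, rfl⟩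
  rw [dim, dim, if_neg (hne _ (Set.mem_univ y₀)), if_neg (hne _ (hy₀ y₀ rfl)), ← direction_affineSpan,
    affineSpan_convexHull, direction_affineSpan, hspan, ← direction_affineSpan ℝ (convexHull ℝ _),
    affineSpan_convexHull, direction_affineSpan]

theorem card_sub_card (hP : IsSimplexSum n π P L) [Nonempty α] :
    (Fintype.card α : ℤ) - Nat.card Q = ((n - 1) * Nat.card Q : ℕ) := by
  have hn := hP.n_pos
  rw [hP.card_eq]
  push_cast [Nat.cast_sub (show 1 ≤ n from hn)]
  ring

end IsSimplexSum

end Configurations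

end FrobPoly

namespace FrobPoly

/-! ### The generating function. -/

section Counting

open Polynomial

theorem sum_ssubsets_X_pow_card {α : Type*} [DecidableEq α] (s : Finset α) :
    ∑ t ∈ s.ssubsets, (X : ℤ[X]) ^ t.card = (1 + X) ^ s.card - X ^ s.card := by
  have h := Finset.sum_pow_mul_eq_add_pow (X : ℤ[X]) 1 s
  rw [← Finset.insert_erase (Finset.mem_powerset_self s), Finset.sum_insert (by simp)] at h
  rw [Finset.ssubsets, add_comm 1 (X : ℤ[X]), ← h]
  simp

variable {α Q : Type*} [Fintype α]

/-- The generating function, by cardinality, of the sets that omit a point of each fiber of `π`,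
if all fibers have `n` elements. -/
theorem ncard_omitting_eq_coeff [Finite Q] {n : ℕ} {π : α → Q}
    (hπ : ∀ q, {a | π a = q}.ncard = n) (j : ℕ) :
    ({Y : Set α | (∀ q, ∃ a, π a = q ∧ a ∉ Y) ∧ Y.ncard = j}.ncard : ℤ) =
      (((1 + X) ^ n - X ^ n) ^ Nat.card Q : ℤ[X]).coeff j := by
  classical
  have := Fintype.ofFinite Q
  let fib : Q → Finset α := fun q => Finset.univ.filter fun a => π a = q
  have hfib : ∀ q, (fib q).card = n := fun q => by
    rw [← hπ q, Set.ncard_eq_toFinset_card']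
    congr 1
    ext; simp [fib]
  let S : Finset (Finset α) := Finset.univ.filter fun Y => ∀ q, ∃ a, π a = q ∧ a ∉ Y
  have hgen : (((1 + X) ^ n - X ^ n) ^ Nat.card Q : ℤ[X]) = ∑ Y ∈ S, X ^ Y.card := by
    have h1 : (((1 + X) ^ n - X ^ n) ^ Nat.card Q : ℤ[X]) =
        ∏ q : Q, ∑ t ∈ (fib q).ssubsets, (X : ℤ[X]) ^ t.card := by
      simp [sum_ssubsets_X_pow_card, hfib]
    -- Expanding the product chooses a proper subset of each fiber; their union is the omitting set.
    rw [h1, Finset.prod_univ_sum]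
    symm
    refine Finset.sum_bij' (fun Y _ q => Y.filter fun a => π a = q)
      (fun p _ => Finset.univ.biUnion p) ?_ ?_ ?_ ?_ ?_
    · intro Y hY
      rw [Fintype.mem_piFinset]
      intro q
      rw [Finset.mem_ssubsets, Finset.ssubset_iff_of_subset (Finset.filter_subset_filter _ (by simp))]
      obtain ⟨a, ha, haY⟩ := (Finset.mem_filter.mp hY).2 q
      exact ⟨a, by simp [ha], by simp [haY]⟩
    · intro p hp
      rw [Fintype.mem_piFinset] at hp
      refine Finset.mem_filter.mpr ⟨Finset.mem_univ _, fun q => ?_⟩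
      obtain ⟨a, ha, hap⟩ := Finset.exists_of_ssubset (Finset.mem_ssubsets.mp (hp q))
      have haq : π a = q := by simpa [fib] using ha
      refine ⟨a, haq, fun hmem => ?_⟩
      obtain ⟨q', -, hq'⟩ := Finset.mem_biUnion.mp hmem
      have : π a = q' := by simpa [fib] using (Finset.mem_ssubsets.mp (hp q')).subset hq'
      rw [← this, haq] at hq'
      exact hap hq'
    · intro Y _
      ext a
      simp
    · intro p hp
      rw [Fintype.mem_piFinset] at hp
      have hpq : ∀ q, ∀ a ∈ p q, π a = q := fun q a ha => by
        simpa [fib] using (Finset.mem_ssubsets.mp (hp q)).subset ha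
      ext q a
      simp only [Finset.mem_filter, Finset.mem_biUnion, Finset.mem_univ, true_and]
      constructor
      · rintro ⟨⟨q', hq'⟩, haq⟩
        rw [hpq q' a hq'] at haq
        exact haq ▸ hq'
      · intro ha
        exact ⟨⟨q, ha⟩, hpq q a ha⟩
    · intro Y _
      rw [Finset.prod_pow_eq_pow_sum, Finset.card_eq_sum_card_fiberwise (f := π)
        (t := Finset.univ) (by simp)]
  rw [hgen, finsetSum_coeff]
  simp only [coeff_X_pow, Finset.sum_boole]
  congr 1
  have hset : {Y : Set α | (∀ q, ∃ a, π a = q ∧ a ∉ Y) ∧ Y.ncard = j} =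
      (fun Y : Finset α => (Y : Set α)) '' (S.filter fun Y => j = Y.card : Finset (Finset α)) := by
    ext Y
    constructor
    · rintro ⟨h1, h2⟩
      refine ⟨Y.toFinset, ?_, by simp⟩
      simp only [S, Finset.coe_filter, Finset.mem_filter, Finset.mem_univ, true_and,
        Set.mem_ofPred_eq, Set.mem_toFinset]
      exact ⟨h1, by rw [← h2, Set.ncard_eq_toFinset_card']⟩
    · rintro ⟨Z, hZ, rfl⟩
      simp only [S, Finset.coe_filter, Finset.mem_filter, Finset.mem_univ, true_and,
        Set.mem_ofPred_eq] at hZ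
      exact ⟨by simpa using hZ.1, by simp [hZ.2]⟩
  rw [hset, Set.ncard_image_of_injective _ Finset.coe_injective, Set.ncard_coe_finset]

/-- For n > 0, the base has degree n - 1 and leading coefficient n; its power will count the facets.
-/
theorem coeff_top_pow (n h : ℕ) :
    ((((1 + X) ^ n - X ^ n) ^ h : ℤ[X])).coeff ((n - 1) * h) = (n : ℤ) ^ h := by
  have hcoeff : ∀ j, ((1 + X) ^ n - X ^ n : ℤ[X]).coeff j = n.choose j - if j = n then 1 else 0 := by
    intro j
    rw [coeff_sub, coeff_one_add_X_pow, coeff_X_pow]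
  rcases n.eq_zero_or_pos with rfl | hn
  · rcases h.eq_zero_or_pos with rfl | hh
    · simp
    · simp [hh.ne']
  have hdeg : ((1 + X) ^ n - X ^ n : ℤ[X]).natDegree ≤ n - 1 := by
    rw [natDegree_le_iff_coeff_eq_zero]
    intro j hj
    rw [hcoeff]
    rcases (show n ≤ j by omega).eq_or_lt with rfl | hlt
    · simp
    · simp [Nat.choose_eq_zero_of_lt hlt, hlt.ne']
  rw [mul_comm, coeff_pow_of_natDegree_le hdeg, hcoeff, if_neg (by omega),
    ← Nat.choose_symm (by omega), Nat.sub_sub_self hn]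
  simp

end Counting

/-! ### Facets and face numbers of free sums. -/

namespace IsSimplexSum

variable {α Q E : Type*} [AddCommGroup E] [Module ℝ E] [Fintype α]
  {n : ℕ} {π : α → Q} {P : α → E} {L : α → E →ₗ[ℝ] ℝ}

/-- A surjection between finite sets of equal size is a bijection. -/
theorem omits_and_ncard_compl_iff (hP : IsSimplexSum n π P L) (X : Set α) :
    ((∀ q, ∃ a, π a = q ∧ a ∉ X) ∧ Xᶜ.ncard = Nat.card Q) ↔ ∀ q, ∃! a, a ∈ Xᶜ ∧ π a = q := by
  have := hP.finite_fibers
  constructor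
  · rintro ⟨h1, h2⟩
    have hsurj : Function.Surjective fun a : (Xᶜ : Set α) => π a := fun q => by
      obtain ⟨a, ha, haX⟩ := h1 q
      exact ⟨⟨a, haX⟩, ha⟩
    have hbij := hsurj.bijective_of_nat_card_le (by rw [Nat.card_coe_set_eq, h2])
    intro q
    obtain ⟨a, ha⟩ := hsurj q
    refine ⟨a, ⟨a.2, ha⟩, fun b hb => ?_⟩
    exact congrArg Subtype.val (hbij.injective (a₁ := ⟨b, hb.1⟩) (a₂ := a) (hb.2.trans ha.symm))
  · intro h
    refine ⟨fun q => ?_, ?_⟩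
    · obtain ⟨a, ⟨haX, ha⟩, -⟩ := h q
      exact ⟨a, ha, haX⟩
    · rw [← Nat.card_coe_set_eq]
      refine Nat.card_eq_of_bijective (fun a : (Xᶜ : Set α) => π a) ⟨?_, fun q => ?_⟩
      · intro a b hab
        exact Subtype.ext ((h (π b)).unique ⟨a.2, hab⟩ ⟨b.2, rfl⟩)
      · obtain ⟨a, ⟨haX, ha⟩, -⟩ := h q
        exact ⟨⟨a, haX⟩, ha⟩

variable [Nonempty α]

theorem isFacet_iff (hP : IsSimplexSum n π P L)
    (F : Set E) : IsFacet (convexHull ℝ (P '' Set.univ)) F ↔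
    ∃ X : Set α, (∀ q, ∃! a, a ∈ Xᶜ ∧ π a = q) ∧ F = convexHull ℝ (P '' X) := by
  have hc : ∀ X : Set α, (X.ncard : ℤ) + Xᶜ.ncard = Fintype.card α := fun X => by
    rw [← Nat.card_eq_fintype_card]; exact_mod_cast Set.ncard_add_ncard_compl X
  simp only [← hP.omits_and_ncard_compl_iff]
  constructor
  · rintro ⟨hF, hd⟩
    have hne : F ≠ convexHull ℝ (P '' Set.univ) := by rintro rfl; omega
    obtain ⟨X, hX, rfl⟩ := (hP.isFace_ne_iff F).mp ⟨hF, hne⟩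
    refine ⟨X, ⟨hX, ?_⟩, rfl⟩
    rw [hP.dim_of_omits hX, hP.dim_convexHull_univ] at hd
    have := hc X
    omega
  · rintro ⟨X, ⟨hX, hX'⟩, rfl⟩
    refine ⟨hP.isFace_of_omits hX, ?_⟩
    rw [hP.dim_of_omits hX, hP.dim_convexHull_univ]
    have := hc X
    omega

theorem isSimplicialPolytope (hP : IsSimplexSum n π P L)
    : IsSimplicialPolytope (convexHull ℝ (P '' Set.univ)) := by
  refine ⟨⟨_, Set.toFinite _, rfl⟩, fun F hF => ?_⟩
  obtain ⟨X, hX, rfl⟩ := (hP.isFacet_iff F).mp hF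
  have := hP.affineIndependent_of_omits ((hP.omits_and_ncard_compl_iff X).mpr hX).1
  refine ⟨P '' X, Set.toFinite _, ?_, rfl⟩
  have h2 := this.range
  rwa [← Set.image_eq_range] at h2

theorem setOf_isFace_dim_eq (hP : IsSimplexSum n π P L) (j : ℕ) :
    {F | IsFace (convexHull ℝ (P '' Set.univ)) F ∧ dim F = (j : ℤ) - 1} =
      (fun Y : Set α => convexHull ℝ (P '' Y)) ''
        {Y | (∀ q, ∃ a, π a = q ∧ a ∉ Y) ∧ Y.ncard = j} ∪
      {F | F = convexHull ℝ (P '' Set.univ) ∧ j = (n - 1) * Nat.card Q + 1} := by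
  have hdim := hP.dim_convexHull_univ
  rw [hP.card_sub_card] at hdim
  ext F
  simp only [Set.mem_union, Set.mem_ofPred_eq, Set.mem_image]
  constructor
  · rintro ⟨hF, hd⟩
    by_cases hne : F = convexHull ℝ (P '' Set.univ)
    · right
      refine ⟨hne, ?_⟩
      rw [hne, hdim] at hd
      omega
    · left
      obtain ⟨X, hX, rfl⟩ := (hP.isFace_ne_iff F).mp ⟨hF, hne⟩
      rw [hP.dim_of_omits hX] at hd
      exact ⟨X, ⟨hX, by omega⟩, rfl⟩
  · rintro (⟨X, ⟨hX, rfl⟩, rfl⟩ | ⟨rfl, rfl⟩)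
    · exact ⟨hP.isFace_of_omits hX, hP.dim_of_omits hX⟩
    · refine ⟨isFace_self _, ?_⟩
      rw [hdim]; push_cast; ring

theorem ncard_isFace_dim_eq (hP : IsSimplexSum n π P L) (j : ℕ) :
    ({F | IsFace (convexHull ℝ (P '' Set.univ)) F ∧ dim F = (j : ℤ) - 1}.ncard : ℤ) =
      ((Polynomial.X ^ ((n - 1) * Nat.card Q + 1) +
        ((1 + Polynomial.X) ^ n - Polynomial.X ^ n) ^ Nat.card Q : ℤ[X])).coeff j := by
  have := hP.finite_fibers
  have hdisj : Disjoint ((fun Y : Set α => convexHull ℝ (P '' Y)) ''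
        {Y | (∀ q, ∃ a, π a = q ∧ a ∉ Y) ∧ Y.ncard = j})
      {F | F = convexHull ℝ (P '' Set.univ) ∧ j = (n - 1) * Nat.card Q + 1} := by
    rw [Set.disjoint_left]
    rintro _ ⟨X, ⟨hX, -⟩, rfl⟩ ⟨h, -⟩
    exact ((hP.isFace_ne_iff _).mpr ⟨X, hX, rfl⟩).2 h
  rw [hP.setOf_isFace_dim_eq, Set.ncard_union_eq hdisj (Set.toFinite _)
    ((Set.finite_singleton (convexHull ℝ (P '' Set.univ))).subset fun F hF => hF.1),
    Set.ncard_image_of_injective _ hP.convexHull_image_injective, Polynomial.coeff_add,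
    ← ncard_omitting_eq_coeff hP.ncard_fiber, Nat.cast_add, add_comm, Polynomial.coeff_X_pow]
  congr 1
  split_ifs with h <;> simp [h]

theorem ncard_isFacet (hP : IsSimplexSum n π P L) :
    {F | IsFacet (convexHull ℝ (P '' Set.univ)) F}.ncard = n ^ Nat.card Q := by
  -- This index is dim P, one below the exponent of the monomial that accounts for P itself.
  have h := hP.ncard_isFace_dim_eq ((n - 1) * Nat.card Q)
  rw [Polynomial.coeff_add, coeff_top_pow, Polynomial.coeff_X_pow, if_neg (by omega), zero_add,
    ← hP.card_sub_card, ← hP.dim_convexHull_univ] at h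
  exact_mod_cast h

end IsSimplexSum

end FrobPoly

namespace FrobPoly

/-! ### Permutation matrices as a free sum of simplices. -/

section FrobeniusPolytope

/-- The Frobenius inner product with a fixed real matrix. -/
noncomputable def matrixInner {ι : Type*} [Fintype ι] (A : Matrix ι ι ℝ) :
    Matrix ι ι ℝ →ₗ[ℝ] ℝ where
  toFun M := ∑ i, ∑ j, A i j * M i j
  map_add' M M' := by simp [mul_add, Finset.sum_add_distrib]
  map_smul' c M := by simp [Finset.mul_sum, mul_left_comm]

theorem matrixInner_apply {ι : Type*} [Fintype ι] (A M : Matrix ι ι ℝ) :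
    matrixInner A M = ∑ i, ∑ j, A i j * M i j := rfl

theorem matrixInner_comm {ι : Type*} [Fintype ι] (A M : Matrix ι ι ℝ) :
    matrixInner A M = matrixInner M A := by
  simp [matrixInner_apply, mul_comm]

theorem matrixInner_self_eq_zero {ι : Type*} [Fintype ι] {A : Matrix ι ι ℝ}
    (h : matrixInner A A = 0) : A = 0 := by
  ext i j
  have h1 := (Finset.sum_eq_zero_iff_of_nonneg
    fun i _ => Finset.sum_nonneg fun j _ => mul_self_nonneg (A i j)).mp h i (Finset.mem_univ i)
  exact mul_self_eq_zero.mp ((Finset.sum_eq_zero_iff_of_nonneg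
    fun j _ => mul_self_nonneg (A i j)).mp h1 j (Finset.mem_univ j))

variable {G : Type*} [Group G] {H : Subgroup G}

-- The inner product counts the points where g and k agree.
open Classical in
theorem matrixInner_permMatrix [Fintype (G ⧸ H)] (g k : G) :
    matrixInner (permMatrix H g) (permMatrix H k) =
      ∑ x : G ⧸ H, (if (g⁻¹ * k) • x = x then (1 : ℝ) else 0) := by
  rw [matrixInner_apply, Finset.sum_comm]
  refine Finset.sum_congr rfl fun x _ => ?_
  simp only [permMatrix, Matrix.of_apply, ite_mul, one_mul, zero_mul, Finset.sum_ite_eq,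
    Finset.mem_univ, if_true, mul_smul, inv_smul_eq_iff]

variable [Finite G]

open Classical in
theorem sum_fixed_eq [Fintype (G ⧸ H)] (hH : FixesAtMostOne H) (g : G) :
    ∑ x : G ⧸ H, (if g • x = x then (1 : ℝ) else 0) =
      (if g = 1 then (Nat.card (G ⧸ H) : ℝ) else 0) + 1 -
        (if g ∈ frobeniusKernelSubgroup hH then 1 else 0) := by
  simp only [mem_frobeniusKernelSubgroup]
  by_cases hg1 : g = 1
  · subst hg1
    simp [frobeniusKernel]
  by_cases hg : g ∈ frobeniusKernel H
  · have : ∀ x : G ⧸ H, g • x ≠ x := hg.resolve_left hg1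
    simp [hg, hg1, this]
  · obtain ⟨-, x, hx⟩ := exists_smul_eq_of_notMem hg
    rw [Finset.sum_eq_single x]
    · simp [hg, hg1, hx]
    · intro y _ hy
      rw [if_neg fun h => hy (hH g hg1 y x h hx)]
    · simp

/-- Burnside counting: the fixed points number |G| by transitivity, and n + |G| - |N| by
`sum_fixed_eq`. -/
theorem card_frobeniusKernelSubgroup (hH : FixesAtMostOne H) :
    Nat.card (frobeniusKernelSubgroup hH) = Nat.card (G ⧸ H) := by
  classical
  have := Fintype.ofFinite G
  have := Fintype.ofFinite H
  have := Fintype.ofFinite (G ⧸ H)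
  have h1 : ∑ g : G, ∑ x : G ⧸ H, (if g • x = x then (1 : ℝ) else 0) = Nat.card G := by
    rw [Finset.sum_comm, H.card_eq_card_quotient_mul_card_subgroup]
    have : ∀ x : G ⧸ H, ∑ g : G, (if g • x = x then (1 : ℝ) else 0) = Nat.card H := by
      intro x
      induction x using QuotientGroup.induction_on with | _ x
      rw [sum_stabilizer_eq x fun _ => (1 : ℝ)]
      simp
    simp [this]
  have h2 : ∑ g : G, (if g ∈ frobeniusKernelSubgroup hH then (1 : ℝ) else 0) =
      Nat.card (frobeniusKernelSubgroup hH) := by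
    rw [Finset.sum_boole, Nat.card_eq_fintype_card, Fintype.card_subtype]
  simp only [sum_fixed_eq hH, Finset.sum_sub_distrib, Finset.sum_add_distrib, h2] at h1
  simp only [Finset.sum_ite_eq', Finset.mem_univ, if_true, Finset.sum_const, Finset.card_univ,
    ← Nat.card_eq_fintype_card, nsmul_eq_mul, mul_one] at h1
  have : (Nat.card (frobeniusKernelSubgroup hH) : ℝ) = Nat.card (G ⧸ H) := by linarith
  exact_mod_cast this

theorem card_quotient_frobeniusKernelSubgroup (hH : FixesAtMostOne H) :
    Nat.card (G ⧸ frobeniusKernelSubgroup hH) = Nat.card H := by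
  have h1 := (frobeniusKernelSubgroup hH).card_eq_card_quotient_mul_card_subgroup
  rw [H.card_eq_card_quotient_mul_card_subgroup, card_frobeniusKernelSubgroup hH, mul_comm] at h1
  exact (Nat.eq_of_mul_eq_mul_right Nat.card_pos h1).symm

theorem isSimplexSum_permMatrix [Fintype G] [Fintype (G ⧸ H)]
    (hH : IsFrobeniusComplement H ∨ H = ⊥) (hF : FixesAtMostOne H) :
    IsSimplexSum (Nat.card (G ⧸ H))
      (fun g : G => (g : G ⧸ frobeniusKernelSubgroup hF)) (permMatrix H)
      (fun g => matrixInner (permMatrix H g)) where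
  surjective := QuotientGroup.mk_surjective
  ncard_fiber q := by
    induction q using QuotientGroup.induction_on with | _ g
    have : {a : G | (a : G ⧸ frobeniusKernelSubgroup hF) = g} =
        g • (frobeniusKernelSubgroup hF : Set G) := by
      ext a
      rw [Set.mem_smul_set_iff_inv_smul_mem, smul_eq_mul, SetLike.mem_coe, ← QuotientGroup.eq]
      exact eq_comm
    rw [this, Set.ncard_smul_set, ← card_frobeniusKernelSubgroup hF, ← Nat.card_coe_set_eq]
    rfl
  gram a b := by
    classical
    rw [matrixInner_permMatrix, sum_fixed_eq hF]
    simp only [inv_mul_eq_one, ← QuotientGroup.eq, eq_comm]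
  eq_zero f hf := by
    -- A combination orthogonal to all the generators is orthogonal to itself.
    apply matrixInner_self_eq_zero
    conv_lhs => rw [_root_.map_sum]
    refine Finset.sum_eq_zero fun a _ => ?_
    rw [map_smul, matrixInner_comm, hf, smul_zero]
  two_le := by
    rcases hH with ⟨-, hlt, -⟩ | rfl
    · left
      have h1 : H.index ≠ 1 := fun h => hlt.ne (Subgroup.index_eq_one.mp h)
      have h0 : H.index ≠ 0 := Subgroup.FiniteIndex.index_ne_zero
      change 2 ≤ H.index
      omega
    · right
      rw [← Finite.card_le_one_iff_subsingleton, card_quotient_frobeniusKernelSubgroup]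
      simp

theorem mem_smul_frobeniusKernel_iff (hF : FixesAtMostOne H) (x g : G) :
    x ∈ g • frobeniusKernel H ↔ (x : G ⧸ frobeniusKernelSubgroup hF) = g := by
  rw [Set.mem_smul_set_iff_inv_smul_mem, smul_eq_mul, ← mem_frobeniusKernelSubgroup hF,
    ← QuotientGroup.eq]
  exact eq_comm

theorem omitsFromEachCoset_iff (hF : FixesAtMostOne H) (X : Set G) :
    OmitsFromEachCoset (frobeniusKernel H) X ↔
      ∀ q : G ⧸ frobeniusKernelSubgroup hF, ∃ a : G, (a : G ⧸ frobeniusKernelSubgroup hF) = q ∧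
        a ∉ X := by
  simp only [OmitsFromEachCoset, mem_smul_frobeniusKernel_iff hF,
    QuotientGroup.mk_surjective.forall]

theorem isCosetTransversal_iff (hF : FixesAtMostOne H) (T : Set G) :
    IsCosetTransversal (frobeniusKernel H) T ↔
      ∀ q : G ⧸ frobeniusKernelSubgroup hF, ∃! a : G, a ∈ T ∧
        (a : G ⧸ frobeniusKernelSubgroup hF) = q := by
  simp only [IsCosetTransversal, mem_smul_frobeniusKernel_iff hF,
    QuotientGroup.mk_surjective.forall]

end FrobeniusPolytope

end FrobPoly

theorem mainTheorem2 {G : Type*} [Group G] [Finite G] (H : Subgroup G)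
    (hH : IsFrobeniusComplement H ∨ H = ⊥) (n h : ℕ)
    (hn : (frobeniusKernel H).ncard = n) (hh : Nat.card H = h) :
    -- simplicial polytope, dimension, number of vertices and of facets
    (IsSimplicialPolytope (frobeniusPolytope H) ∧
      dim (frobeniusPolytope H) = (Nat.card G : ℤ) - (Nat.card H : ℤ) ∧
      dim (frobeniusPolytope H) = ((n : ℤ) - 1) * (h : ℤ) ∧
      (vertices (frobeniusPolytope H)).ncard = Nat.card G ∧
      {F | IsFacet (frobeniusPolytope H) F}.ncard = n ^ h) ∧
    -- the proper faces and their dimensions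
    ((∀ F : Set (Matrix (G ⧸ H) (G ⧸ H) ℝ),
        (IsFace (frobeniusPolytope H) F ∧ F ≠ frobeniusPolytope H) ↔
          ∃ X : Set G, OmitsFromEachCoset (frobeniusKernel H) X ∧ F = hullOf H X) ∧
      ∀ X : Set G, OmitsFromEachCoset (frobeniusKernel H) X →
        dim (hullOf H X) = (X.ncard : ℤ) - 1) ∧
    -- the facets
    ((∀ T : Set G, T.ncard = h → IsCosetTransversal (frobeniusKernel H) T →
        IsFacet (frobeniusPolytope H) (hullOf H Tᶜ) ∧
          vertices (hullOf H Tᶜ) = permMatrix H '' Tᶜ) ∧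
      ∀ F, IsFacet (frobeniusPolytope H) F →
        ∃ T : Set G, T.ncard = h ∧ IsCosetTransversal (frobeniusKernel H) T ∧
          F = hullOf H Tᶜ ∧ vertices F = permMatrix H '' Tᶜ) ∧
    -- the number of faces of dimension `k = j - 1`, for every `k ≥ -1`
    ({F | IsFace (frobeniusPolytope H) F}.Finite ∧
      ∀ j : ℕ, ({F | IsFace (frobeniusPolytope H) F ∧ dim F = (j : ℤ) - 1}.ncard : ℤ) =
        ((Polynomial.X ^ ((n - 1) * h + 1) +
          ((1 + Polynomial.X) ^ n - Polynomial.X ^ n) ^ h : ℤ[X])).coeff j) := by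
  have := Fintype.ofFinite G
  have := Fintype.ofFinite (G ⧸ H)
  have hF := fixesAtMostOne_of_isFrobeniusComplement_or_eq_bot hH
  have hP := isSimplexSum_permMatrix hH hF
  have hcard := card_quotient_frobeniusKernelSubgroup hF
  have hn' : Nat.card (G ⧸ H) = n := by
    rw [← hn, ← card_frobeniusKernelSubgroup hF]; rfl
  rw [hn'] at hP
  rw [hh] at hcard
  have hpoly : frobeniusPolytope H = convexHull ℝ (permMatrix H '' Set.univ) := rfl
  have hdim := hP.dim_convexHull_univ
  have hsub := hP.card_sub_card
  have hn1 : 1 ≤ n := hP.n_pos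
  have hT : ∀ X : Set G, (∀ q : G ⧸ frobeniusKernelSubgroup hF,
      ∃! a : G, a ∈ Xᶜ ∧ (a : G ⧸ frobeniusKernelSubgroup hF) = q) →
      Xᶜ.ncard = h := fun X hX =>
    ((hP.omits_and_ncard_compl_iff X).mpr hX).2.trans hcard
  rw [hcard] at hdim hsub
  rw [← Nat.card_eq_fintype_card] at hdim hsub
  simp only [omitsFromEachCoset_iff hF, isCosetTransversal_iff hF]
  refine ⟨⟨hP.isSimplicialPolytope, ?_, ?_, ?_, ?_⟩, ⟨hP.isFace_ne_iff, ?_⟩, ⟨?_, ?_⟩,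
    finite_setOf_isFace_convexHull_image _ _, ?_⟩
  · rw [hpoly, hdim, hh]
  · rw [hpoly, hdim, hsub]
    push_cast [Nat.cast_sub hn1]
    ring
  · rw [hpoly, hP.vertices_convexHull, Set.ncard_image_of_injective _ hP.injective, Set.ncard_univ]
  · rw [hpoly, hP.ncard_isFacet, hcard]
  · exact fun X hX => hP.dim_of_omits hX
  · intro T _ hTt
    exact ⟨(hP.isFacet_iff _).mpr ⟨Tᶜ, by rwa [compl_compl], rfl⟩, hP.vertices_convexHull _⟩
  · intro F hFF
    obtain ⟨X, hX, rfl⟩ := (hP.isFacet_iff F).mp hFF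
    refine ⟨Xᶜ, hT X hX, hX, ?_, ?_⟩
    · rw [compl_compl]; rfl
    · rw [compl_compl, hP.vertices_convexHull]
  · intro j
    rw [hpoly, hP.ncard_isFace_dim_eq, hcard]
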